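/- Let $q\ge 2$ and let $T$ be a $(q+1)$-valent tree in which every vertex has one predecessor and $q$ successors, such that the $q$ edges from each vertex up to its successors are labelled bijectively by $\{0,1,\dots,q-1\}$. Let $o$ be a basepoint of $T$ such that no edge of the descending ray $o,\ \mathrm{pred}(o),\ \mathrm{pred}^2(o),\dots$ is labelled $1$. For $v\in T$ let $o\curlywedge v$ be the greatest common ancestor of $o$ and $v$, and put $l(v)=d_T(v,o\curlywedge v)$, $m(v)=d_T(o,o\curlywedge v)$, $h(v)=l(v)-m(v)$. Let $T_1,T_2,T_3$ be copies of $T$, with functions $l_i,m_i,h_i$. The graph $DL_3(q)$ has as vertices the triples $v=(v_1,v_2,v_3)$, $v_i\in T_i$, with $\sum_i h_i(v_i)=0$; two vertices $v,w$ are joined by an edge if there are $i\ne j$ such that $v_i,w_i$ are adjacent in $T_i$, $v_j,w_j$ are adjacent in $T_j$, and $v_k=w_k$ for $k\ne i,j$. Identify $DL_3(q)$ with its vertex set, a discrete metric space with the graph metric $d$ and basepoint $id=(o,o,o)$; write $m_i(v)=m_i(v_i)$ and $l_i(v)=l_i(v_i)$. Embed $DL_3(q)$ by $x\mapsto f_x$,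 $f_x(z)=d(x,z)-d(x,id)$, into the space of continuous functions $f:DL_3(q)\to\mathbb R$ with $f(id)=0$, with the compact-open topology; let $\overline{DL_3(q)}$ be the closure of the image and $\partial DL_3(q)=\overline{DL_3(q)}\setminus DL_3(q)$. For $n\ge 0$ let $\beta_n\in DL_3(q)$ be the vertex whose projections to $T_1$ and $T_2$ are the basepoints and whose projection to $T_3$ is reached from the basepoint by $n$ steps down followed by $n$ steps up along edges labelled $1$ (so $m_3(\beta_n)=l_3(\beta_n)=n$). Then the limits $\beta(z)=\lim_{n\to\infty}\bigl(d(\beta_n,z)-d(\beta_n,id)\bigr)$, $z\in DL_3(q)$, exist and define a point $\beta\in\partial DL_3(q)$, and the sets \[N_k(\beta)=\{z\in DL_3(q)\mid m_i(z)=l_i(z)=0\text{ for }i=1,2\text{ and }m_3(z)=l_3(z)\ge k\}\cup\{\beta\},\qquad k\ge 0,\] form a neighborhood basis of $\beta$ in $\overline{DL_3(q)}$. -/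

import Mathlib

open Filter Topology

/-- A `(q+1)`-valent tree on the vertex set `V` in which every vertex `v` has a single predecessor
`pred v` and exactly `q` successors, labelled by `{0, …, q-1}` (`succ v a` is the successor of `v`
with label `a`), together with a basepoint. The neighbours of `v` are its predecessor and its
successors, and the predecessor of `v` is not a successor of `v`. -/
structure LabelledTree (q : ℕ) (V : Type*) where
  graph : SimpleGraph V
  isTree : graph.IsTree
  pred : V → V
  succ : V → Fin q → V
  adj_iff : ∀ v w, graph.Adj v w ↔ w = pred v ∨ v = pred w
  pred_pred_ne : ∀ v, pred (pred v) ≠ v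
  pred_succ : ∀ v a, pred (succ v a) = v
  succ_injective : ∀ v, Function.Injective (succ v)
  exists_succ_pred : ∀ v, ∃ a, succ (pred v) a = v
  base : V

namespace LabelledTree

variable {q : ℕ} {V : Type*} (T : LabelledTree q V)

theorem adj_pred (v : V) : T.graph.Adj v (T.pred v) := (T.adj_iff _ _).2 (Or.inl rfl)

/-- The walk that starts at `v` and descends `n` times. -/
def descend (v : V) : (n : ℕ) → T.graph.Walk v (T.pred^[n] v)
  | 0 => SimpleGraph.Walk.nil
  | n + 1 => SimpleGraph.Walk.cons (T.adj_pred v) (descend (T.pred v) n)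

theorem descend_length (v : V) (n : ℕ) : (T.descend v n).length = n := by
  induction n generalizing v with
  | zero => rfl
  | succ n ih => simp [descend, ih]

theorem descend_isPath (v : V) (n : ℕ) : (T.descend v n).IsPath := by
  rw [T.isTree.isAcyclic.isPath_iff_isChain]
  induction n generalizing v with
  | zero => simp [descend]
  | succ n ih =>
    cases n with
    | zero => simp [descend]
    | succ n =>
      have h := ih (T.pred v)
      simp only [descend] at h ⊢
      refine List.IsChain.cons_cons ?_ h
      intro he
      change s(_, _) = s(_, _) at he
      rw [Sym2.eq_iff] at he
      rcases he with ⟨h1, -⟩ | ⟨h1, -⟩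
      · exact (T.adj_pred v).ne h1
      · exact T.pred_pred_ne v h1.symm

theorem dist_iterate_pred (v : V) (n : ℕ) : T.graph.dist v (T.pred^[n] v) = n := by
  obtain ⟨p, hp, hl⟩ := T.isTree.connected.exists_path_of_dist v (T.pred^[n] v)
  have h := (T.isTree.isAcyclic.subsingleton_path _ _).elim ⟨p, hp⟩ ⟨_, T.descend_isPath v n⟩
  have h' : p = T.descend v n := congrArg Subtype.val h
  rw [← hl, h', T.descend_length]

theorem iterate_pred_injective (v : V) : Function.Injective fun n : ℕ => T.pred^[n] v := by
  intro i j h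
  rw [← T.dist_iterate_pred v i, ← T.dist_iterate_pred v j]
  exact congrArg _ h

/-- Any two vertices have a common ancestor. -/
theorem exists_common_ancestor (v w : V) : ∃ i j : ℕ, T.pred^[i] v = T.pred^[j] w := by
  obtain ⟨p⟩ := T.isTree.connected v w
  induction p with
  | nil => exact ⟨0, 0, rfl⟩
  | @cons u v w h p ih =>
    obtain ⟨i, j, hij⟩ := ih
    rcases (T.adj_iff _ _).1 h with rfl | rfl
    · exact ⟨i + 1, j, by simpa using hij⟩
    · cases i with
      | zero => exact ⟨0, j + 1, by
          rw [Function.iterate_succ_apply', ← hij]; rfl⟩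
      | succ i => exact ⟨i, j, by simpa using hij⟩

open Classical in
/-- The number of steps from `v` down to the first ancestor of `v` that is an ancestor of `w`. -/
noncomputable def meetIndex (v w : V) : ℕ := Nat.find (T.exists_common_ancestor v w)

/-- The greatest common ancestor of `v` and `w` (every vertex is an ancestor of itself). -/
noncomputable def meet (v w : V) : V := T.pred^[T.meetIndex v w] v

theorem meet_isAncestor_left (v w : V) : ∃ i : ℕ, T.pred^[i] v = T.meet v w := ⟨_, rfl⟩

theorem meet_isAncestor_right (v w : V) : ∃ j : ℕ, T.pred^[j] w = T.meet v w := by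
  classical
  obtain ⟨j, hj⟩ := Nat.find_spec (T.exists_common_ancestor v w)
  exact ⟨j, hj.symm⟩

theorem meetIndex_le {v w : V} {i j : ℕ} (h : T.pred^[i] v = T.pred^[j] w) :
    T.meetIndex v w ≤ i := by
  classical
  exact Nat.find_min' _ ⟨j, h⟩

/-- Every common ancestor of `v` and `w` is an ancestor of `meet v w`. -/
theorem isAncestor_meet (v w u : V) (hv : ∃ i : ℕ, T.pred^[i] v = u)
    (hw : ∃ j : ℕ, T.pred^[j] w = u) : ∃ k : ℕ, T.pred^[k] (T.meet v w) = u := by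
  obtain ⟨i, rfl⟩ := hv
  obtain ⟨j, hj⟩ := hw
  refine ⟨i - T.meetIndex v w, ?_⟩
  rw [meet, ← Function.iterate_add_apply, Nat.sub_add_cancel (T.meetIndex_le hj.symm)]

/-- `l(v) = d(v, o ⋏ v)`. -/
noncomputable def l (v : V) : ℕ := T.graph.dist v (T.meet T.base v)

/-- `m(v) = d(o, o ⋏ v)`. -/
noncomputable def m (v : V) : ℕ := T.graph.dist T.base (T.meet T.base v)

/-- The height `h(v) = l(v) - m(v)`. -/
noncomputable def height (v : V) : ℤ := (T.l v : ℤ) - (T.m v : ℤ)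

theorem height_base : T.height T.base = 0 := by
  simp [height, l, m]

theorem height_pred (v : V) : T.height (T.pred v) = T.height v - 1 := by
  obtain ⟨j, hj⟩ := T.meet_isAncestor_right T.base v
  obtain ⟨j', hj'⟩ := T.meet_isAncestor_right T.base (T.pred v)
  have hm : T.m v = T.meetIndex T.base v := T.dist_iterate_pred _ _
  have hm' : T.m (T.pred v) = T.meetIndex T.base (T.pred v) := T.dist_iterate_pred _ _
  have hl : T.l v = j := by rw [l, ← hj, T.dist_iterate_pred]
  have hl' : T.l (T.pred v) = j' := by rw [l, ← hj', T.dist_iterate_pred]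
  have hle : T.meetIndex T.base v ≤ T.meetIndex T.base (T.pred v) :=
    T.meetIndex_le (j := j' + 1) (by
      rw [Function.iterate_succ_apply, hj']; rfl)
  rw [height, height, hm, hm', hl, hl']
  have hj2 : T.pred^[j' + 1] v = T.pred^[T.meetIndex T.base (T.pred v)] T.base := by
    rw [Function.iterate_succ_apply, hj']; rfl
  obtain ⟨c, hc⟩ := Nat.exists_eq_add_of_le hle
  have hj3 : j' + 1 = c + j := by
    apply T.iterate_pred_injective v
    show T.pred^[j' + 1] v = T.pred^[c + j] v
    rw [hj2, hc, Nat.add_comm, Function.iterate_add_apply, Function.iterate_add_apply, hj]; rfl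
  rw [hc]
  push_cast
  omega

theorem height_iterate_pred (v : V) (n : ℕ) : T.height (T.pred^[n] v) = T.height v - n := by
  induction n with
  | zero => simp
  | succ n ih => rw [Function.iterate_succ_apply', height_pred, ih]; push_cast; ring

theorem height_iterate_succ (v : V) (a : Fin q) (n : ℕ) :
    T.height ((fun w => T.succ w a)^[n] v) = T.height v + n := by
  induction n with
  | zero => simp
  | succ n ih =>
    have h := T.height_pred (T.succ ((fun w => T.succ w a)^[n] v) a)
    rw [T.pred_succ, ih] at h
    rw [Function.iterate_succ_apply']
    push_cast
    linarith

end LabelledTree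

/-- The vertex set of the Diestel–Leader graph `DL_d(q)`, built from `d` copies of the tree `T`. -/
def DL {q : ℕ} {V : Type*} (T : LabelledTree q V) (d : ℕ) : Type _ :=
  {v : Fin d → V // ∑ i, T.height (v i) = 0}

namespace DL

variable {q : ℕ} {V : Type*} (T : LabelledTree q V) (d : ℕ)

/-- The graph `DL_d(q)`. -/
def graph : SimpleGraph (DL T d) where
  Adj v w := ∃ i j : Fin d, i ≠ j ∧ T.graph.Adj (v.1 i) (w.1 i) ∧ T.graph.Adj (v.1 j) (w.1 j) ∧
    ∀ k, k ≠ i → k ≠ j → v.1 k = w.1 k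
  symm := ⟨by
    rintro v w ⟨i, j, hij, hi, hj, h⟩
    exact ⟨i, j, hij, hi.symm, hj.symm, fun k h1 h2 => (h k h1 h2).symm⟩⟩
  loopless := ⟨by
    rintro v ⟨i, j, hij, hi, hj, h⟩
    exact hi.ne rfl⟩

/-- The basepoint `(o, …, o)`. -/
def id : DL T d := ⟨fun _ => T.base, by simp [T.height_base]⟩

/-- The vertex set is a discrete space (its metric is the graph metric). -/
instance : TopologicalSpace (DL T d) := ⊥

instance : DiscreteTopology (DL T d) := ⟨rfl⟩

variable {T d}

/-- The graph distance on `DL_d(q)`. -/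
noncomputable def dist (v w : DL T d) : ℕ := (graph T d).dist v w

/-- The function `m_i` on `DL_d(q)`. -/
noncomputable def m (i : Fin d) (v : DL T d) : ℕ := T.m (v.1 i)

/-- The function `l_i` on `DL_d(q)`. -/
noncomputable def l (i : Fin d) (v : DL T d) : ℕ := T.l (v.1 i)

variable (T d)

/-- Continuous real functions on `DL_d(q)` that vanish at the basepoint, with the topology induced
by the compact-open topology. -/
abbrev BasedFun : Type _ := {f : C(DL T d, ℝ) // f (id T d) = 0}

variable {T d}

/-- The map `x ↦ f_x`, `f_x(z) = d(x, z) - d(x, id)`. -/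
noncomputable def toBasedFun (x : DL T d) : BasedFun T d :=
  ⟨⟨fun z => (dist x z : ℝ) - (dist x (id T d) : ℝ), continuous_of_discreteTopology⟩,
    by simp⟩

variable (T d)

/-- The horofunction compactification: the closure of `DL_d(q)` in the space of based functions,
with the subspace topology. -/
abbrev Compactification : Type _ := closure (Set.range (toBasedFun (T := T) (d := d)))

variable {T d}

/-- A vertex of `DL_d(q)` as a point of the compactification. -/
noncomputable def toCompactification (x : DL T d) : Compactification T d :=
  ⟨toBasedFun x, subset_closure (Set.mem_range_self x)⟩

variable (T d)

/-- The horofunction boundary: the points of the compactification that are not vertices. -/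
def horoboundary : Set (Compactification T d) := (Set.range toCompactification)ᶜ

/-- The point `β_n` of `DL_3(q)`: it is the basepoint in the first two trees; in the third tree
it is reached from the basepoint by `n` steps down and then `n` steps up along edges
labelled `a`. -/
def betaSeq (a : Fin q) (n : ℕ) : DL T 3 :=
  ⟨![T.base, T.base, (fun w => T.succ w a)^[n] (T.pred^[n] T.base)], by
    simp [Fin.sum_univ_three, T.height_base, T.height_iterate_succ, T.height_iterate_pred]⟩

variable {T}

/-- The set `N_k(β)`; the trees `T_1, T_2, T_3` have the indices `0, 1, 2`. -/
def basicNhd (β : Compactification T 3) (k : ℕ) : Set (Compactification T 3) :=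
  toCompactification '' {z : DL T 3 | m 0 z = 0 ∧ l 0 z = 0 ∧ m 1 z = 0 ∧ l 1 z = 0 ∧
    m 2 z = l 2 z ∧ k ≤ l 2 z} ∪ {β}

end DL

/-! ### Meet indices in the tree -/

namespace LabelledTree

variable {q : ℕ} {V : Type*} (T : LabelledTree q V)

/-! Let `level T n` be the finite set of vertices over the basepoints of the first two trees with `m
= l = n` in the third, and write f_x(z) = d(x,z) - d(x,id). The proof shows that all levels converge
to β together, and that finitely many strict inequalities near `id` single out the levels.

Convergence. Once n exceeds the `m`-value of the third coordinate of z, a walk from level n to z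
must first descend to the n-th ancestor of the basepoint. That part of the walk can be replayed from
another place of the third tree (`dist_le_add_of_walk`). So d(x,z) is constant on level n and grows
by at most 2 from one level to the next, while d(x,id) = 2n. The integers f_x(z) thus do not
increase with n and are at least -d(z,id), so they become constant (`exists_limit`).

Detection. If f_x is positive at siblings of `id` in the first two trees and negative at the
neighbours of `id` that climb there while the third coordinate descends, then x lies in a level
(`exists_mem_level_of_dist_lt`). β satisfies these inequalities, so they define an open set W
containing β. If y in W differs from β at z, only finitely many vertices lie in W and differ from β
at z; by density y is one of them. Removing the finitely many low vertices from W leaves a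
neighbourhood inside N_k. Conversely, a neighbourhood of β constrains finitely many values, and high
levels have the same values there as β. -/

theorem meetIndex_spec (v w : V) : ∃ j : ℕ, T.pred^[T.meetIndex v w] v = T.pred^[j] w := by
  classical exact Nat.find_spec (T.exists_common_ancestor v w)

theorem iterate_pred_meetIndex (v w : V) :
    T.pred^[T.meetIndex v w] v = T.pred^[T.meetIndex w v] w := by
  obtain ⟨j, hj⟩ := T.meetIndex_spec v w
  obtain ⟨i, hi⟩ := T.meetIndex_spec w v
  have h1 := T.meetIndex_le hj.symm
  have h2 := T.meetIndex_le hi.symm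
  have h3 := congrArg T.height hj
  have h4 := congrArg T.height hi
  simp only [height_iterate_pred] at h3 h4
  have : T.meetIndex w v = j := by omega
  rw [this, hj]

theorem height_sub_meetIndex (v w : V) :
    T.height v - T.meetIndex v w = T.height w - T.meetIndex w v := by
  have h := congrArg T.height (T.iterate_pred_meetIndex v w)
  simpa only [height_iterate_pred] using h

theorem meetIndex_self (v : V) : T.meetIndex v v = 0 :=
  Nat.le_zero.1 (T.meetIndex_le (i := 0) (j := 0) rfl)

theorem meetIndex_pred (v w : V) : T.meetIndex (T.pred v) w = T.meetIndex v w - 1 := by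
  obtain ⟨j, hj⟩ := T.meetIndex_spec v w
  obtain ⟨j', hj'⟩ := T.meetIndex_spec (T.pred v) w
  have h1 : T.meetIndex v w ≤ T.meetIndex (T.pred v) w + 1 :=
    T.meetIndex_le (j := j') (by rw [← hj', Function.iterate_succ_apply])
  rcases Nat.eq_zero_or_pos (T.meetIndex v w) with h | h
  · rw [h] at hj
    have : T.meetIndex (T.pred v) w ≤ 0 :=
      T.meetIndex_le (j := j + 1) (by rw [Function.iterate_succ_apply', ← hj]; rfl)
    omega
  · obtain ⟨c, hc⟩ := Nat.exists_eq_add_of_lt h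
    have : T.meetIndex (T.pred v) w ≤ c :=
      T.meetIndex_le (j := j) (by rw [← hj, hc, ← Function.iterate_succ_apply]; congr 1; simp)
    omega

/-- One step down either shortens the descent of `v` to the meet, or, if `v` is already an ancestor
of `w`, lengthens the climb to `w`; the other index does not change. This is the bookkeeping for a
single edge of a walk. -/
theorem meetIndex_pred_cases (v w : V) :
    (T.meetIndex v w = T.meetIndex (T.pred v) w + 1 ∧
      T.meetIndex w v = T.meetIndex w (T.pred v)) ∨
    (T.meetIndex v w = 0 ∧ T.meetIndex (T.pred v) w = 0 ∧
      T.meetIndex w (T.pred v) = T.meetIndex w v + 1) := by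
  have h1 := T.meetIndex_pred v w
  have h2 := T.height_sub_meetIndex v w
  have h3 := T.height_sub_meetIndex (T.pred v) w
  rw [T.height_pred] at h3
  omega

theorem m_eq (v : V) : T.m v = T.meetIndex T.base v := T.dist_iterate_pred _ _

theorem l_eq (v : V) : T.l v = T.meetIndex v T.base := by
  rw [l, meet, iterate_pred_meetIndex, T.dist_iterate_pred]

theorem eq_base_of_m_l {v : V} (hm : T.m v = 0) (hl : T.l v = 0) : v = T.base := by
  have h := T.iterate_pred_meetIndex v T.base
  rw [← T.m_eq, ← T.l_eq, hm, hl] at h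
  exact h

theorem m_base : T.m T.base = 0 := by rw [m_eq, meetIndex_self]

theorem l_base : T.l T.base = 0 := by rw [l_eq, meetIndex_self]

theorem height_succ (v : V) (a : Fin q) : T.height (T.succ v a) = T.height v + 1 := by
  have := T.height_pred (T.succ v a)
  rw [T.pred_succ] at this
  omega

theorem exists_succ_ne (hq : 2 ≤ q) (v w : V) : ∃ a, T.succ v a ≠ w := by
  by_contra! h
  have : (⟨0, by omega⟩ : Fin q) = ⟨1, hq⟩ := T.succ_injective v ((h _).trans (h _).symm)
  simp at this

theorem finite_iterate_pred_eq (u : V) (n : ℕ) : {v : V | T.pred^[n] v = u}.Finite := by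
  induction n generalizing u with
  | zero => simp
  | succ n ih =>
    have : {v : V | T.pred^[n + 1] v = u} ⊆ ⋃ a : Fin q, {v | T.pred^[n] v = T.succ u a} := by
      intro v hv
      rw [Set.mem_ofPred_eq, Function.iterate_succ_apply'] at hv
      obtain ⟨a, ha⟩ := T.exists_succ_pred (T.pred^[n] v)
      rw [hv] at ha
      exact Set.mem_iUnion.2 ⟨a, ha.symm⟩
    exact (Set.finite_iUnion fun a => ih _).subset this

theorem exists_iterate_pred_eq (u : V) (n : ℕ) : ∃ v, T.pred^[n] v = u := by
  obtain ⟨a, -⟩ := T.exists_succ_pred u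
  induction n generalizing u with
  | zero => exact ⟨u, rfl⟩
  | succ n ih =>
    obtain ⟨v, hv⟩ := ih (T.succ u a)
    exact ⟨v, by rw [Function.iterate_succ_apply', hv, T.pred_succ]⟩

/-- If `x` meets the basepoint after exactly `n` steps on both sides, and `n` exceeds the depth at
which `z` meets the basepoint, then `x` and `z` meet where `x` and the basepoint do. -/
theorem le_meetIndex_of_m_lt {x z : V} {n : ℕ} (hm : T.m x = n) (hl : T.l x = n)
    (hz : T.m z < n) : n ≤ T.meetIndex x z := by
  by_contra! h
  obtain ⟨c, rfl⟩ := Nat.exists_eq_add_of_lt hz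
  have h0 := T.iterate_pred_meetIndex x z
  have h1 : T.pred^[T.m z] T.base = T.pred^[T.l z] z := by
    rw [m_eq, l_eq, iterate_pred_meetIndex]
  have e1 := congrArg T.height h0
  have e2 := congrArg T.height h1
  have ex : T.height x = 0 := by rw [height, hm, hl, sub_self]
  simp only [height_iterate_pred, height_base] at e1 e2
  obtain ⟨e, he⟩ := Nat.exists_eq_add_of_le (Nat.lt_succ_iff.1 h)
  have h2 : T.pred^[T.m z + c] x = T.pred^[e + T.meetIndex z x] z := by
    rw [he, Nat.add_comm, Function.iterate_add_apply, h0, Function.iterate_add_apply]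
  have h3 : T.pred^[T.m z + c] T.base = T.pred^[c + T.l z] z := by
    rw [Nat.add_comm, Function.iterate_add_apply, h1, Function.iterate_add_apply]
  -- Meeting `z` too early would make `x` meet the basepoint after at most n - 1 steps, against `l x
  -- = n`.
  have h4 : T.pred^[T.m z + c] x = T.pred^[T.m z + c] T.base := by
    have h5 : e + T.meetIndex z x = c + T.l z := by omega
    rw [h2, h3, h5]
  have h5 := T.meetIndex_le h4
  rw [← l_eq] at h5
  omega

end LabelledTree

/-! ### Changing coordinates, and the shape of an edge -/

namespace DL

variable {q : ℕ} {V : Type*} {T : LabelledTree q V} {d : ℕ}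

theorem sum_add_sum_congr {f g : Fin d → ℤ} {i j : Fin d} (hij : i ≠ j)
    (h : ∀ k, k ≠ i → k ≠ j → f k = g k) :
    ∑ k, f k + (g i + g j) = ∑ k, g k + (f i + f j) := by
  have hj : j ∈ (Finset.univ : Finset (Fin d)).erase i :=
    Finset.mem_erase.2 ⟨hij.symm, Finset.mem_univ j⟩
  have e : ∀ f : Fin d → ℤ,
      ∑ k, f k = f i + (f j + ∑ k ∈ (Finset.univ.erase i).erase j, f k) := fun f => by
    rw [Finset.add_sum_erase _ f hj, Finset.add_sum_erase _ f (Finset.mem_univ i)]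
  rw [e f, e g, Finset.sum_congr rfl fun k hk => h k
    (Finset.ne_of_mem_erase (Finset.mem_of_mem_erase hk)) (Finset.ne_of_mem_erase hk)]
  ring

theorem sum_add_congr {f g : Fin d → ℤ} {i : Fin d} (h : ∀ k, k ≠ i → f k = g k) :
    ∑ k, f k + g i = ∑ k, g k + f i := by
  rw [← Finset.add_sum_erase _ f (Finset.mem_univ i),
    ← Finset.add_sum_erase _ g (Finset.mem_univ i),
    Finset.sum_congr rfl fun k hk => h k (Finset.ne_of_mem_erase hk)]
  ring

/-- Replace the `i`-th coordinate by a vertex of the same height. -/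
def replace (v : DL T d) (i : Fin d) (u : V) (h : T.height u = T.height (v.1 i)) : DL T d :=
  ⟨Function.update v.1 i u, by
    have e := sum_add_congr (f := fun k => T.height (Function.update v.1 i u k))
      (g := fun k => T.height (v.1 k)) (i := i) fun k hk => by simp [hk]
    have e' := v.2
    simp only [Function.update_self] at e
    omega⟩

/-- Replace two coordinates, keeping the sum of their heights. -/
def replace₂ (v : DL T d) {i j : Fin d} (hij : i ≠ j) (u w : V)
    (h : T.height u + T.height w = T.height (v.1 i) + T.height (v.1 j)) : DL T d :=
  ⟨Function.update (Function.update v.1 j w) i u, by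
    have e := sum_add_sum_congr
      (f := fun k => T.height (Function.update (Function.update v.1 j w) i u k))
      (g := fun k => T.height (v.1 k)) hij fun k hi hj => by simp [hi, hj]
    have e' := v.2
    simp only [Function.update_self, Function.update_of_ne hij.symm] at e
    omega⟩

theorem replace_apply_self (v : DL T d) (i : Fin d) (u : V) (h) :
    (v.replace i u h).1 i = u := by simp [replace]

theorem replace_apply_ne (v : DL T d) (i : Fin d) (u : V) (h) {k : Fin d} (hk : k ≠ i) :
    (v.replace i u h).1 k = v.1 k := by simp [replace, hk]

theorem replace₂_apply_left (v : DL T d) {i j : Fin d} (hij : i ≠ j) (u w : V) (h) :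
    (v.replace₂ hij u w h).1 i = u := by simp [replace₂]

theorem replace₂_apply_right (v : DL T d) {i j : Fin d} (hij : i ≠ j) (u w : V) (h) :
    (v.replace₂ hij u w h).1 j = w := by simp [replace₂, hij.symm]

theorem replace₂_apply_ne (v : DL T d) {i j : Fin d} (hij : i ≠ j) (u w : V) (h) {k : Fin d}
    (hi : k ≠ i) (hj : k ≠ j) : (v.replace₂ hij u w h).1 k = v.1 k := by
  simp [replace₂, hi, hj]

theorem height_eq_of_forall_ne {v w : DL T d} {i : Fin d} (h : ∀ k, k ≠ i → w.1 k = v.1 k) :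
    T.height (w.1 i) = T.height (v.1 i) := by
  have e := sum_add_congr (f := fun k => T.height (w.1 k)) (g := fun k => T.height (v.1 k))
    (i := i) fun k hk => by rw [h k hk]
  have := v.2
  have := w.2
  omega

theorem height_add_eq_of_forall_ne {v w : DL T d} {i j : Fin d} (hij : i ≠ j)
    (h : ∀ k, k ≠ i → k ≠ j → w.1 k = v.1 k) :
    T.height (w.1 i) + T.height (w.1 j) = T.height (v.1 i) + T.height (v.1 j) := by
  have e := sum_add_sum_congr (f := fun k => T.height (w.1 k)) (g := fun k => T.height (v.1 k))
    hij fun k hi hj => by rw [h k hi hj]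
  have := v.2
  have := w.2
  omega

/-- In an edge, one coordinate goes up, another one goes down, and the rest is fixed. -/
theorem exists_up_down {v w : DL T d} (h : (graph T d).Adj v w) :
    ∃ i j : Fin d, i ≠ j ∧ v.1 i = T.pred (w.1 i) ∧ w.1 j = T.pred (v.1 j) ∧
      ∀ k, k ≠ i → k ≠ j → v.1 k = w.1 k := by
  obtain ⟨i, j, hij, hi, hj, hk⟩ := h
  have e := height_add_eq_of_forall_ne hij hk
  rcases (T.adj_iff _ _).1 hi with hi | hi <;> rcases (T.adj_iff _ _).1 hj with hj | hj
  · have := T.height_pred (v.1 i); have := T.height_pred (v.1 j)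
    rw [hi, hj] at e; omega
  · exact ⟨j, i, hij.symm, hj, hi, fun k h1 h2 => hk k h2 h1⟩
  · exact ⟨i, j, hij, hi, hj, hk⟩
  · have := T.height_pred (w.1 i); have := T.height_pred (w.1 j)
    rw [hi, hj] at e; omega

theorem dist_comm (v w : DL T d) : dist v w = dist w v := SimpleGraph.dist_comm

end DL

/-! ### Walks, connectedness and distance bounds -/

namespace DL

variable {q : ℕ} {V : Type*} {T : LabelledTree q V} {d : ℕ}

theorem ext_of_forall_ne {v w : DL T d} {i : Fin d} (hi : v.1 i = w.1 i)
    (h : ∀ k, k ≠ i → v.1 k = w.1 k) : v = w := by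
  refine Subtype.ext (funext fun k => ?_)
  rcases eq_or_ne k i with rfl | hk
  exacts [hi, h k hk]

theorem adj_of_up_down {v w : DL T d} {i j : Fin d} (hij : i ≠ j) (hi : v.1 i = T.pred (w.1 i))
    (hj : w.1 j = T.pred (v.1 j)) (h : ∀ k, k ≠ i → k ≠ j → v.1 k = w.1 k) :
    (graph T d).Adj v w :=
  ⟨i, j, hij, (T.adj_iff _ _).2 (Or.inr hi), (T.adj_iff _ _).2 (Or.inl hj), h⟩

/-- The `i`-th coordinate climbs `n` steps while the `j`-th coordinate descends `n` steps. -/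
theorem exists_walk_slide {i j : Fin d} (hij : i ≠ j) {n : ℕ} {x y : DL T d}
    (hi : T.pred^[n] (y.1 i) = x.1 i) (hj : y.1 j = T.pred^[n] (x.1 j))
    (h : ∀ k, k ≠ i → k ≠ j → x.1 k = y.1 k) : ∃ p : (graph T d).Walk x y, p.length = n := by
  induction n generalizing x with
  | zero =>
    have : x = y := by
      refine ext_of_forall_ne (i := i) hi.symm fun k hk => ?_
      rcases eq_or_ne k j with rfl | hk'
      exacts [hj.symm, h k hk hk']
    subst this
    exact ⟨.nil, rfl⟩
  | succ n ih =>
    have e : T.height (T.pred^[n] (y.1 i)) + T.height (T.pred (x.1 j)) =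
        T.height (x.1 i) + T.height (x.1 j) := by
      rw [← hi, Function.iterate_succ_apply', T.height_pred, T.height_pred]; ring
    obtain ⟨p, hp⟩ := ih (x := x.replace₂ hij _ _ e) (by rw [replace₂_apply_left])
      (by rw [replace₂_apply_right, hj]; rfl)
      (fun k h1 h2 => by rw [replace₂_apply_ne _ _ _ _ _ h1 h2, h k h1 h2])
    refine ⟨.cons (adj_of_up_down hij ?_ ?_ ?_) p, by simp [hp]⟩
    · rw [replace₂_apply_left, ← hi, Function.iterate_succ_apply']
    · rw [replace₂_apply_right]
    · intro k h1 h2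
      rw [replace₂_apply_ne _ _ _ _ _ h1 h2]

/-- Two vertices that differ in one coordinate only are joined by a walk in which that coordinate
descends to the meet and climbs again. -/
theorem exists_walk_of_forall_ne {i j : Fin d} (hij : i ≠ j) {v w : DL T d}
    (h : ∀ k, k ≠ i → w.1 k = v.1 k) :
    ∃ p : (graph T d).Walk v w, p.length = 2 * T.meetIndex (v.1 i) (w.1 i) := by
  obtain ⟨y, hy⟩ := T.exists_iterate_pred_eq (v.1 j) (T.meetIndex (v.1 i) (w.1 i))
  have e1 := height_eq_of_forall_ne h
  have e2 := T.height_sub_meetIndex (v.1 i) (w.1 i)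
  have e3 : T.meetIndex (w.1 i) (v.1 i) = T.meetIndex (v.1 i) (w.1 i) := by omega
  have e4 := T.iterate_pred_meetIndex (v.1 i) (w.1 i)
  rw [e3] at e4
  have e : T.height (T.pred^[T.meetIndex (v.1 i) (w.1 i)] (v.1 i)) + T.height y =
      T.height (v.1 i) + T.height (v.1 j) := by
    rw [← hy, T.height_iterate_pred, T.height_iterate_pred]; ring
  obtain ⟨p, hp⟩ := exists_walk_slide hij.symm (x := v) (y := v.replace₂ hij _ _ e)
    (by rw [replace₂_apply_right, hy]) (by rw [replace₂_apply_left])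
    (fun k h1 h2 => by rw [replace₂_apply_ne _ _ _ _ _ h2 h1])
  obtain ⟨p', hp'⟩ := exists_walk_slide hij.symm (x := w) (y := v.replace₂ hij _ _ e)
    (n := T.meetIndex (v.1 i) (w.1 i))
    (by rw [replace₂_apply_right, hy, h j hij.symm]) (by rw [replace₂_apply_left, e4])
    (fun k h1 h2 => by rw [replace₂_apply_ne _ _ _ _ _ h2 h1, h k h2])
  exact ⟨p.append p'.reverse, by rw [SimpleGraph.Walk.length_append,
    SimpleGraph.Walk.length_reverse, hp, hp']; ring⟩

/-- Coordinate `j` is a counterweight: it climbs while coordinate `i` descends to its meet with `u`,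
and descends while `i` climbs to `u`. -/
theorem exists_reachable_apply_eq {i j : Fin d} (hij : i ≠ j) (v : DL T d) (u : V) :
    ∃ w, (graph T d).Reachable v w ∧ w.1 i = u ∧ ∀ k, k ≠ i → k ≠ j → w.1 k = v.1 k := by
  obtain ⟨y, hy⟩ := T.exists_iterate_pred_eq (v.1 j) (T.meetIndex (v.1 i) u)
  have e : T.height (T.pred^[T.meetIndex (v.1 i) u] (v.1 i)) + T.height y =
      T.height (v.1 i) + T.height (v.1 j) := by
    rw [← hy, T.height_iterate_pred, T.height_iterate_pred]; ring
  have e' : T.height u + T.height (T.pred^[T.meetIndex u (v.1 i)] y) =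
      T.height (v.1 i) + T.height (v.1 j) := by
    have := T.height_sub_meetIndex (v.1 i) u
    rw [T.height_iterate_pred] at e ⊢
    omega
  obtain ⟨p, -⟩ := exists_walk_slide hij.symm (x := v) (y := v.replace₂ hij _ _ e)
    (by rw [replace₂_apply_right, hy]) (by rw [replace₂_apply_left])
    (fun k h1 h2 => by rw [replace₂_apply_ne _ _ _ _ _ h2 h1])
  obtain ⟨p', -⟩ := exists_walk_slide hij (x := v.replace₂ hij _ _ e)
    (y := v.replace₂ hij _ _ e') (n := T.meetIndex u (v.1 i))
    (by rw [replace₂_apply_left, replace₂_apply_left, T.iterate_pred_meetIndex])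
    (by rw [replace₂_apply_right, replace₂_apply_right])
    (fun k h1 h2 => by rw [replace₂_apply_ne _ _ _ _ _ h1 h2, replace₂_apply_ne _ _ _ _ _ h1 h2])
  exact ⟨_, ⟨p.append p'⟩, replace₂_apply_left _ _ _ _ _,
    fun k h1 h2 => replace₂_apply_ne _ _ _ _ _ h1 h2⟩

theorem reachable (v w : DL T 3) : (graph T 3).Reachable v w := by
  obtain ⟨x, hx, hx0, -⟩ := exists_reachable_apply_eq (i := 0) (j := 2) (by decide) v (w.1 0)
  obtain ⟨y, hy, hy1, hy0⟩ :=
    exists_reachable_apply_eq (i := 1) (j := 2) (by decide) x (w.1 1)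
  have h : ∀ k, k ≠ 2 → w.1 k = y.1 k := by
    intro k hk
    fin_cases k
    · exact hx0.symm.trans (hy0 0 (by decide) (by decide)).symm
    · exact hy1.symm
    · exact absurd rfl hk
  obtain ⟨p, -⟩ := exists_walk_of_forall_ne (j := 0) (by decide) h
  exact (hx.trans hy).trans ⟨p⟩

theorem connected : (graph T 3).Connected :=
  (SimpleGraph.connected_iff _).2 ⟨reachable, ⟨id T 3⟩⟩

theorem dist_triangle (u v w : DL T 3) : dist u w ≤ dist u v + dist v w :=
  connected.dist_triangle

theorem dist_slide_le {i j : Fin d} (hij : i ≠ j) {n : ℕ} {x y : DL T d}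
    (hi : T.pred^[n] (y.1 i) = x.1 i) (hj : y.1 j = T.pred^[n] (x.1 j))
    (h : ∀ k, k ≠ i → k ≠ j → x.1 k = y.1 k) : dist x y ≤ n := by
  obtain ⟨p, hp⟩ := exists_walk_slide hij hi hj h
  exact hp ▸ SimpleGraph.dist_le p

theorem dist_le_of_forall_ne {i j : Fin d} (hij : i ≠ j) {v w : DL T d}
    (h : ∀ k, k ≠ i → w.1 k = v.1 k) : dist v w ≤ 2 * T.meetIndex (v.1 i) (w.1 i) := by
  obtain ⟨p, hp⟩ := exists_walk_of_forall_ne hij h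
  exact hp ▸ SimpleGraph.dist_le p

theorem exists_walk_dist (v w : DL T 3) : ∃ p : (graph T 3).Walk v w, p.length = dist v w :=
  (reachable v w).exists_walk_length_eq_dist

/-- Let a, b be the descent and climb required of coordinate `i`, and c, d those of `j`. An edge has
only one descending and one climbing coordinate. If `i` is at its lowest first, its a descents share
no edge with the c descents of `j` and precede the d climbs, which in turn share no edge with the b
climbs: both a + c + d and a + b + d are lower bounds. Otherwise c + d + b is one. The term a + b +
d makes the induction close: for c = 0 it keeps the first alternative from undercutting the second.
-/
theorem le_walk_length {i j : Fin d} (hij : i ≠ j) {v z : DL T d} (p : (graph T d).Walk v z) :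
    min (max (T.meetIndex (v.1 i) (z.1 i) + T.meetIndex (z.1 i) (v.1 i) +
          T.meetIndex (z.1 j) (v.1 j))
        (T.meetIndex (v.1 i) (z.1 i) + T.meetIndex (v.1 j) (z.1 j) +
          T.meetIndex (z.1 j) (v.1 j)))
      (T.meetIndex (v.1 j) (z.1 j) + T.meetIndex (z.1 j) (v.1 j) +
        T.meetIndex (z.1 i) (v.1 i)) ≤ p.length := by
  induction p with
  | nil => simp [T.meetIndex_self]
  | @cons v v' z h p ih =>
    rw [SimpleGraph.Walk.length_cons]
    obtain ⟨a, b, hab, ha, hb, hk⟩ := exists_up_down h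
    have up := T.meetIndex_pred_cases (v'.1 a) (z.1 a)
    have down := T.meetIndex_pred_cases (v.1 b) (z.1 b)
    rw [← ha] at up
    rw [← hb] at down
    clear ha hb h
    by_cases hia : i = a
    · subst hia
      by_cases hjb : j = b
      · subst hjb
        clear hk
        rcases up with ⟨u1, u2⟩ | ⟨u1, u2, u3⟩ <;> rcases down with ⟨d1, d2⟩ | ⟨d1, d2, d3⟩ <;>
          omega
      · rw [hk j hij.symm hjb]
        clear hk
        omega
    by_cases hib : i = b
    · subst hib
      by_cases hja : j = a
      · subst hja
        clear hk
        rcases up with ⟨u1, u2⟩ | ⟨u1, u2, u3⟩ <;> rcases down with ⟨d1, d2⟩ | ⟨d1, d2, d3⟩ <;>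
          omega
      · rw [hk j hja hij.symm]
        clear hk
        omega
    rw [hk i hia hib]
    by_cases hja : j = a
    · subst hja
      clear hk down
      omega
    by_cases hjb : j = b
    · subst hjb
      clear hk up
      omega
    · rw [hk j hja hjb]
      omega

/-- A lower bound for the distance: coordinate `j` has to travel to its target, and coordinate `i`
has to descend before, or to climb after, coordinate `j` is at its lowest. -/
theorem meetIndex_add_le_dist {i j : Fin 3} (hij : i ≠ j) (v z : DL T 3) :
    T.meetIndex (v.1 j) (z.1 j) + T.meetIndex (z.1 j) (v.1 j) +
      min (T.meetIndex (v.1 i) (z.1 i)) (T.meetIndex (z.1 i) (v.1 i)) ≤ dist v z := by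
  obtain ⟨p, hp⟩ := exists_walk_dist v z
  have := le_walk_length hij p
  omega

/-- If a walk from `v` to `z` has to pass through the `n`-th ancestor of `v i`, then the part of the
walk before can be moved to another place of the `i`-th tree. -/
theorem dist_le_add_of_walk {i : Fin 3} {v w z : DL T 3} {n C : ℕ} {A B : V}
    (hC : ∀ v' w' : DL T 3, (∀ k, k ≠ i → w'.1 k = v'.1 k) → v'.1 i = A → w'.1 i = B →
      dist w' v' ≤ C)
    (h : ∀ k, k ≠ i → w.1 k = v.1 k) (hv : T.pred^[n] (v.1 i) = A) (hw : T.pred^[n] (w.1 i) = B)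
    (hz : n ≤ T.meetIndex (v.1 i) (z.1 i)) (p : (graph T 3).Walk v z) :
    dist w z ≤ p.length + C := by
  induction p generalizing w n with
  | @nil v =>
    rw [T.meetIndex_self, Nat.le_zero] at hz
    subst hz
    simpa using hC _ _ h hv hw
  | @cons v v' z hvv' p ih =>
    cases n with
    | zero =>
      have h1 := hC _ _ h hv hw
      have h2 : dist v z ≤ (SimpleGraph.Walk.cons hvv' p).length := SimpleGraph.dist_le _
      have := dist_triangle w v z
      omega
    | succ n =>
      -- The copy imitates the walk edge by edge, with the same motion in every coordinate, until
      -- coordinate `i` reaches `A` and its copy reaches `B`.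
      suffices ∃ w' n', (graph T 3).Adj w w' ∧ (∀ k, k ≠ i → w'.1 k = v'.1 k) ∧
          T.pred^[n'] (v'.1 i) = A ∧ T.pred^[n'] (w'.1 i) = B ∧
          n' ≤ T.meetIndex (v'.1 i) (z.1 i) by
        obtain ⟨w', n', hww', h', hv', hw', hz'⟩ := this
        have h1 := ih h' hv' hw' hz'
        have h2 : dist w w' ≤ 1 := SimpleGraph.dist_le hww'.toWalk
        have := dist_triangle w w' z
        rw [SimpleGraph.Walk.length_cons]
        omega
      obtain ⟨a, b, hab, ha, hb, hk⟩ := exists_up_down hvv'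
      have e := height_eq_of_forall_ne h
      by_cases hia : i = a
      · subst hia
        -- Any label will do: only the ancestor `B` is remembered, now one step further down.
        obtain ⟨c, -⟩ := T.exists_succ_pred (w.1 i)
        refine ⟨v'.replace i (T.succ (w.1 i) c) ?_, n + 1 + 1, adj_of_up_down hab ?_ ?_ ?_,
          fun k hk => replace_apply_ne _ _ _ _ hk, ?_, ?_, ?_⟩
        · rw [T.height_succ, e, ha, T.height_pred]; ring
        · rw [replace_apply_self, T.pred_succ]
        · rw [replace_apply_ne _ _ _ _ hab.symm, hb, h _ hab.symm]
        · intro k h1 h2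
          rw [replace_apply_ne _ _ _ _ h1, h k h1, hk k h1 h2]
        · rw [Function.iterate_succ_apply, ← ha, hv]
        · rw [replace_apply_self, Function.iterate_succ_apply, T.pred_succ, hw]
        · rw [ha, T.meetIndex_pred] at hz
          omega
      by_cases hib : i = b
      · subst hib
        refine ⟨v'.replace i (T.pred (w.1 i)) ?_, n, adj_of_up_down hab ?_ ?_ ?_,
          fun k hk => replace_apply_ne _ _ _ _ hk, ?_, ?_, ?_⟩
        · rw [hb, T.height_pred, T.height_pred, e]
        · rw [replace_apply_ne _ _ _ _ hab, h _ hab, ha]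
        · rw [replace_apply_self]
        · intro k h1 h2
          rw [replace_apply_ne _ _ _ _ h2, h k h2, hk k h1 h2]
        · rw [hb]; exact hv
        · rw [replace_apply_self]; exact hw
        · rw [hb, T.meetIndex_pred]
          omega
      · have e' := hk i hia hib
        refine ⟨v'.replace i (w.1 i) ?_, n + 1, adj_of_up_down hab ?_ ?_ ?_,
          fun k hk => replace_apply_ne _ _ _ _ hk, ?_, ?_, ?_⟩
        · rw [e, e']
        · rw [replace_apply_ne _ _ _ _ (Ne.symm hia), h _ (Ne.symm hia), ha]
        · rw [replace_apply_ne _ _ _ _ (Ne.symm hib), h _ (Ne.symm hib), hb]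
        · intro k h1 h2
          rcases eq_or_ne k i with rfl | hki
          · rw [replace_apply_self]
          · rw [replace_apply_ne _ _ _ _ hki, h k hki, hk k h1 h2]
        · rw [← e', hv]
        · rw [replace_apply_self, hw]
        · rw [← e']; exact hz

theorem dist_le_add {i : Fin 3} {v w z : DL T 3} {n C : ℕ} {A B : V}
    (hC : ∀ v' w' : DL T 3, (∀ k, k ≠ i → w'.1 k = v'.1 k) → v'.1 i = A → w'.1 i = B →
      dist w' v' ≤ C)
    (h : ∀ k, k ≠ i → w.1 k = v.1 k) (hv : T.pred^[n] (v.1 i) = A) (hw : T.pred^[n] (w.1 i) = B)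
    (hz : n ≤ T.meetIndex (v.1 i) (z.1 i)) : dist w z ≤ dist v z + C := by
  obtain ⟨p, hp⟩ := exists_walk_dist v z
  exact hp ▸ dist_le_add_of_walk hC h hv hw hz p

/-- Here `A = B`, so the copied walk merges with the original one at no cost. -/
theorem dist_le_of_iterate_pred_eq {i : Fin 3} {v w z : DL T 3} {n : ℕ}
    (h : ∀ k, k ≠ i → w.1 k = v.1 k) (hvw : T.pred^[n] (v.1 i) = T.pred^[n] (w.1 i))
    (hz : n ≤ T.meetIndex (v.1 i) (z.1 i)) : dist w z ≤ dist v z := by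
  refine dist_le_add (C := 0) (fun v' w' h' hv' hw' => ?_) h hvw rfl hz
  rw [ext_of_forall_ne (hw'.trans hv'.symm) h']
  exact SimpleGraph.dist_self.le

/-- Here `A` and `B` have the same predecessor, and two edges lead from one to the other. -/
theorem dist_le_add_two_of_iterate_pred_eq {i : Fin 3} {v w z : DL T 3} {n : ℕ}
    (h : ∀ k, k ≠ i → w.1 k = v.1 k) (hvw : T.pred^[n + 1] (v.1 i) = T.pred^[n + 1] (w.1 i))
    (hz : n ≤ T.meetIndex (v.1 i) (z.1 i)) : dist w z ≤ dist v z + 2 := by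
  refine dist_le_add (C := 2) (fun v' w' h' hv' hw' => ?_) h rfl rfl hz
  obtain ⟨j, hij⟩ : ∃ j, i ≠ j := ⟨i + 1, by fin_cases i <;> decide⟩
  refine (dist_le_of_forall_ne hij fun k hk => (h' k hk).symm).trans ?_
  have : T.meetIndex (w'.1 i) (v'.1 i) ≤ 1 := T.meetIndex_le (j := 1) (by
    rw [hv', hw', ← Function.iterate_add_apply, ← Function.iterate_add_apply, Nat.add_comm, hvw])
  omega

end DL

/-! ### Levels and the limit along them -/

namespace LabelledTree

variable {q : ℕ} {V : Type*} (T : LabelledTree q V)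

theorem iterate_pred_l {v : V} : T.pred^[T.l v] v = T.pred^[T.m v] T.base := by
  rw [l_eq, m_eq, iterate_pred_meetIndex]

theorem meetIndex_iterate_pred (v w : V) (n : ℕ) :
    T.meetIndex (T.pred^[n] v) w = T.meetIndex v w - n := by
  induction n with
  | zero => rfl
  | succ n ih => rw [Function.iterate_succ_apply', meetIndex_pred, ih]; omega

theorem eq_of_meetIndex_eq_zero {v w : V} (h : T.meetIndex v w = 0) :
    v = T.pred^[T.meetIndex w v] w := by
  rw [← T.iterate_pred_meetIndex, h]; rfl

end LabelledTree

namespace DL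

variable {q : ℕ} {V : Type*} {T : LabelledTree q V}

variable (T) in
/-- The vertices over the basepoints of the first two trees whose third coordinate is reached by
descending and then climbing exactly `n` steps. -/
def level (n : ℕ) : Set (DL T 3) :=
  {x | x.1 0 = T.base ∧ x.1 1 = T.base ∧ T.m (x.1 2) = n ∧ T.l (x.1 2) = n}

theorem level_apply_ne {n : ℕ} {x : DL T 3} (hx : x ∈ level T n) {k : Fin 3} (hk : k ≠ 2) :
    x.1 k = T.base := by
  fin_cases k
  exacts [hx.1, hx.2.1, absurd rfl hk]

theorem level_iterate_pred {n : ℕ} {x : DL T 3} (hx : x ∈ level T n) :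
    T.pred^[n] (x.1 2) = T.pred^[n] T.base := by
  have := T.iterate_pred_l (v := x.1 2)
  rwa [hx.2.2.1, hx.2.2.2] at this

theorem level_finite (n : ℕ) : (level T n).Finite := by
  refine Set.Finite.of_finite_image
    ((T.finite_iterate_pred_eq (T.pred^[n] T.base) n).subset ?_) (f := fun x => x.1 2) ?_
  · rintro _ ⟨x, hx, rfl⟩
    exact level_iterate_pred hx
  · intro x hx y hy h
    exact ext_of_forall_ne h fun k hk => by rw [level_apply_ne hx hk, level_apply_ne hy hk]

theorem mem_basicNhd {β y : Compactification T 3} {k : ℕ} :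
    y ∈ basicNhd β k ↔ (∃ n, k ≤ n ∧ ∃ x ∈ level T n, toCompactification x = y) ∨ y = β := by
  refine or_congr ⟨?_, ?_⟩ Iff.rfl
  · rintro ⟨x, ⟨h1, h2, h3, h4, h5, h6⟩, rfl⟩
    exact ⟨_, h6, x, ⟨T.eq_base_of_m_l h1 h2, T.eq_base_of_m_l h3 h4, h5, rfl⟩, rfl⟩
  · rintro ⟨n, hn, x, hx, rfl⟩
    refine ⟨x, ⟨?_, ?_, ?_, ?_, hx.2.2.1.trans hx.2.2.2.symm, hn.trans hx.2.2.2.ge⟩, rfl⟩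
    · exact (congrArg T.m hx.1).trans T.m_base
    · exact (congrArg T.l hx.1).trans T.l_base
    · exact (congrArg T.m hx.2.1).trans T.m_base
    · exact (congrArg T.l hx.2.1).trans T.l_base

theorem iterate_pred_iterate_succ (a : Fin q) (v : V) (n : ℕ) :
    T.pred^[n] ((fun w => T.succ w a)^[n] v) = v := by
  induction n generalizing v with
  | zero => rfl
  | succ n ih => rw [Function.iterate_succ_apply', Function.iterate_succ_apply, ih, T.pred_succ]

/-- The first upward edge leaves the descending ray, since no edge of the ray has label `a`; hence
the basepoint is not met before n steps. -/
theorem betaSeq_mem_level {a : Fin q}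
    (hT : ∀ n : ℕ, T.succ (T.pred^[n + 1] T.base) a ≠ T.pred^[n] T.base) (n : ℕ) :
    betaSeq T a n ∈ level T n := by
  refine ⟨rfl, rfl, ?_⟩
  change T.m ((fun w => T.succ w a)^[n] (T.pred^[n] T.base)) = n ∧
    T.l ((fun w => T.succ w a)^[n] (T.pred^[n] T.base)) = n
  set x := (fun w => T.succ w a)^[n] (T.pred^[n] T.base) with hx
  have h1 : T.pred^[n] x = T.pred^[n] T.base := iterate_pred_iterate_succ _ _ _
  have h2 : T.height x = 0 := by
    rw [hx, T.height_iterate_succ, T.height_iterate_pred, T.height_base]; ring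
  have h3 : T.m x = T.l x := by rw [LabelledTree.height] at h2; omega
  have h4 : T.l x ≤ n := by rw [T.l_eq]; exact T.meetIndex_le h1
  suffices T.l x = n from ⟨h3.trans this, this⟩
  by_contra h
  obtain ⟨c, hc⟩ := Nat.exists_eq_add_of_lt (lt_of_le_of_ne h4 h)
  have h5 := T.iterate_pred_l (v := x)
  rw [h3] at h5
  have h6 : T.pred^[n - 1] x = T.pred^[n - 1] T.base := by
    rw [show n - 1 = c + T.l x by omega, Function.iterate_add_apply, h5,
      ← Function.iterate_add_apply]
  obtain ⟨n, rfl⟩ : ∃ n', n = n' + 1 := ⟨n - 1, by omega⟩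
  rw [hx, Function.iterate_succ_apply, Nat.add_sub_cancel, iterate_pred_iterate_succ] at h6
  exact hT n h6

theorem dist_le_of_mem_level {n : ℕ} {x y z : DL T 3} (hx : x ∈ level T n) (hy : y ∈ level T n)
    (hz : T.m (z.1 2) < n) : dist y z ≤ dist x z :=
  dist_le_of_iterate_pred_eq (fun k hk => by rw [level_apply_ne hx hk, level_apply_ne hy hk])
    (by rw [level_iterate_pred hx, level_iterate_pred hy])
    (T.le_meetIndex_of_m_lt hx.2.2.1 hx.2.2.2 hz)

theorem dist_le_add_two_of_mem_level {n : ℕ} {x y z : DL T 3} (hx : x ∈ level T n)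
    (hy : y ∈ level T (n + 1)) (hz : T.m (z.1 2) < n) : dist y z ≤ dist x z + 2 :=
  dist_le_add_two_of_iterate_pred_eq
    (fun k hk => by rw [level_apply_ne hx hk, level_apply_ne hy hk])
    (by rw [level_iterate_pred hy, Function.iterate_succ_apply', level_iterate_pred hx,
      Function.iterate_succ_apply'])
    (T.le_meetIndex_of_m_lt hx.2.2.1 hx.2.2.2 hz)

theorem dist_id_of_mem_level {n : ℕ} {x : DL T 3} (hx : x ∈ level T n) :
    dist x (id T 3) = 2 * n := by
  apply le_antisymm
  · have := dist_le_of_forall_ne (i := 2) (j := 0) (by decide) (v := x) (w := id T 3)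
      fun k hk => (level_apply_ne hx hk).symm
    change _ ≤ 2 * T.meetIndex (x.1 2) T.base at this
    rwa [← T.l_eq, hx.2.2.2] at this
  · have := meetIndex_add_le_dist (i := 0) (j := 2) (by decide) x (id T 3)
    change T.meetIndex (x.1 2) T.base + T.meetIndex T.base (x.1 2) + _ ≤ _ at this
    rw [← T.l_eq, ← T.m_eq, hx.2.2.2, hx.2.2.1] at this
    omega

/-- A vertex of a lower level is no closer to `x` than `id` is, so the limit is nonnegative on every
level. -/
theorem two_mul_le_dist_of_mem_level {n k : ℕ} {x y : DL T 3} (hx : x ∈ level T n)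
    (hy : y ∈ level T k) (hk : k < n) : 2 * n ≤ dist x y := by
  have h1 := meetIndex_add_le_dist (i := 0) (j := 2) (by decide) x y
  have h2 := T.le_meetIndex_of_m_lt hx.2.2.1 hx.2.2.2 (hy.2.2.1.trans_lt hk)
  have h3 := T.height_sub_meetIndex (x.1 2) (y.1 2)
  rw [LabelledTree.height, LabelledTree.height, hx.2.2.1, hx.2.2.2, hy.2.2.1, hy.2.2.2] at h3
  omega

theorem exists_limit (h : ∀ n, (level T n).Nonempty) (z : DL T 3) :
    ∃ b : ℤ, ∃ K, ∀ n, K ≤ n → ∀ x ∈ level T n, (dist x z : ℤ) - dist x (id T 3) = b := by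
  choose B hB using h
  -- Bounds f_x(z) below by -d(z,id), and keeps the natural subtraction in the minimum below from
  -- truncating.
  have h0 : ∀ n, 2 * n ≤ dist (B n) z + dist z (id T 3) := fun n => by
    rw [← dist_id_of_mem_level (hB n)]
    exact dist_triangle _ _ _
  obtain ⟨N, hN, hmin⟩ : ∃ N, T.m (z.1 2) < N ∧ ∀ n, T.m (z.1 2) < n →
      (dist (B N) z : ℤ) - 2 * N ≤ dist (B n) z - 2 * n := by
    obtain ⟨_, ⟨N, hN, rfl⟩, h⟩ := wellFounded_lt.has_min
      ((fun n => dist (B n) z + dist z (id T 3) - 2 * n) '' {n | T.m (z.1 2) < n})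
      ⟨_, _, Nat.lt_succ_self (T.m (z.1 2)), rfl⟩
    refine ⟨N, hN, fun n hn => ?_⟩
    have h1 := h _ ⟨n, hn, rfl⟩
    have h2 := h0 N
    have h3 := h0 n
    simp only at h1
    omega
  refine ⟨dist (B N) z - 2 * N, N, fun n hn x hx => ?_⟩
  -- The sequence does not increase past `N`, where it is already minimal.
  have h1 : (dist (B n) z : ℤ) - 2 * n ≤ dist (B N) z - 2 * N := by
    induction n, hn using Nat.le_induction generalizing x with
    | base => rfl
    | succ n hn ih =>
      have := dist_le_add_two_of_mem_level (hB n) (hB (n + 1)) (hN.trans_le hn)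
      have := ih _ (hB n)
      push_cast
      omega
  have h2 := hmin n (hN.trans_le hn)
  have h3 := dist_le_of_mem_level hx (hB n) (hN.trans_le hn)
  have h4 := dist_le_of_mem_level (hB n) hx (hN.trans_le hn)
  rw [dist_id_of_mem_level hx]
  push_cast
  omega

/-! ### Test points that detect the levels -/

variable (T) in
/-- The basepoint with its `i`-th coordinate replaced by a sibling of the basepoint. -/
def siblingPoint (i : Fin 3) (w : V) (hw : T.pred w = T.pred T.base) : DL T 3 :=
  (id T 3).replace i w (by
    have := congrArg T.height hw
    rw [T.height_pred, T.height_pred] at this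
    exact sub_left_injective this)

variable (T) in
/-- The neighbour of the basepoint that is one step up in the `i`-th tree, one step down in the
third tree. -/
def succPoint {i : Fin 3} (hi : i ≠ 2) (a : Fin q) : DL T 3 :=
  (id T 3).replace₂ hi (T.succ T.base a) (T.pred T.base) (by
    rw [T.height_succ, T.height_pred]
    change _ = T.height T.base + T.height T.base
    ring)

theorem dist_id_lt_dist_siblingPoint {i : Fin 3} (hi : i ≠ 2) {w : V}
    (hw : T.pred w = T.pred T.base) (hne : w ≠ T.base) {n : ℕ} {x : DL T 3}
    (hx : x ∈ level T n) : dist x (id T 3) < dist x (siblingPoint T i w hw) := by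
  have h := meetIndex_add_le_dist hi x (siblingPoint T i w hw)
  have e1 : (siblingPoint T i w hw).1 i = w := replace_apply_self _ _ _ _
  have e2 : (siblingPoint T i w hw).1 2 = T.base := replace_apply_ne _ _ _ _ hi.symm
  rw [e1, e2, level_apply_ne hx hi, ← T.l_eq, ← T.m_eq, hx.2.2.1, hx.2.2.2] at h
  have h1 := T.height_sub_meetIndex T.base w
  have h2 := congrArg T.height hw
  rw [T.height_pred, T.height_pred] at h2
  have h3 : T.meetIndex T.base w ≠ 0 := fun h0 => by
    have := T.eq_of_meetIndex_eq_zero h0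
    rw [show T.meetIndex w T.base = 0 by omega] at this
    exact hne this.symm
  rw [dist_id_of_mem_level hx]
  omega

/-- The first step down in the third tree can be paired with the step up in tree `i`; correcting the
third coordinate then takes n - 1 steps down and as many up, 2n - 1 in all. -/
theorem dist_succPoint_lt_dist_id {i : Fin 3} (hi : i ≠ 2) (a : Fin q) {n : ℕ} (hn : 0 < n)
    {x : DL T 3} (hx : x ∈ level T n) : dist x (succPoint T hi a) < dist x (id T 3) := by
  obtain ⟨n, rfl⟩ := Nat.exists_eq_succ_of_ne_zero hn.ne'
  have e1 : (succPoint T hi a).1 i = T.succ T.base a := replace₂_apply_left _ _ _ _ _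
  have e2 : (succPoint T hi a).1 2 = T.pred T.base := replace₂_apply_right _ _ _ _ _
  have e3 : ∀ k, k ≠ i → k ≠ 2 → (succPoint T hi a).1 k = T.base :=
    fun k h1 h2 => replace₂_apply_ne _ _ _ _ _ h1 h2
  have e : T.height (T.succ T.base a) + T.height (T.pred (x.1 2)) =
      T.height (x.1 i) + T.height (x.1 2) := by
    rw [T.height_succ, T.height_pred, level_apply_ne hx hi]; ring
  have h1 : dist x (x.replace₂ hi _ _ e) ≤ 1 := dist_slide_le hi
    (by rw [replace₂_apply_left, level_apply_ne hx hi]; exact T.pred_succ _ _)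
    (by rw [replace₂_apply_right]; rfl)
    (fun k h1 h2 => by rw [replace₂_apply_ne _ _ _ _ _ h1 h2])
  have h2 : dist (x.replace₂ hi _ _ e) (succPoint T hi a) ≤ _ :=
    dist_le_of_forall_ne hi.symm fun k hk => by
      rcases eq_or_ne k i with rfl | hki
      · rw [e1, replace₂_apply_left]
      · rw [e3 k hki hk, replace₂_apply_ne _ _ _ _ _ hki hk, level_apply_ne hx hk]
  rw [replace₂_apply_right, e2] at h2
  have h3 : T.meetIndex (T.pred (x.1 2)) (T.pred T.base) ≤ n :=
    T.meetIndex_le (j := n) (level_iterate_pred hx)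
  have := dist_triangle x (x.replace₂ hi _ _ e) (succPoint T hi a)
  rw [dist_id_of_mem_level hx]
  omega

/-- Otherwise walks from `id` to `x` pass through the predecessor of the basepoint in tree `i`, and
the sibling is as good a start. -/
theorem m_eq_zero_of_dist_lt {i : Fin 3} {w : V} (hw : T.pred w = T.pred T.base) {x : DL T 3}
    (h : dist x (id T 3) < dist x (siblingPoint T i w hw)) : T.m (x.1 i) = 0 := by
  by_contra hm
  refine h.not_ge ?_
  rw [dist_comm x, dist_comm x]
  refine dist_le_of_iterate_pred_eq (i := i) (n := 1) (fun k hk => replace_apply_ne _ _ _ _ hk)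
    ?_ ?_
  · rw [siblingPoint, replace_apply_self]; exact hw.symm
  · change 1 ≤ T.meetIndex T.base _
    rw [← T.m_eq]; omega

/-- The first two coordinates only climb, and the third descends to pay for them. With a, b the
lengths of these climbs, correcting the third costs 2(m - a - b) = 2l, as the heights sum to zero;
the total is a + b + 2l = m + l. -/
theorem dist_id_le {x : DL T 3} (h0 : T.m (x.1 0) = 0) (h1 : T.m (x.1 1) = 0) :
    dist (id T 3) x ≤ T.m (x.1 2) + T.l (x.1 2) := by
  have hs : T.height (x.1 0) + T.height (x.1 1) + T.height (x.1 2) = 0 := by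
    rw [← Fin.sum_univ_three fun k => T.height (x.1 k)]; exact x.2
  have p0 := T.iterate_pred_l (v := x.1 0)
  have p1 := T.iterate_pred_l (v := x.1 1)
  rw [h0] at p0
  rw [h1] at p1
  simp only [LabelledTree.height, h0, h1] at hs
  set a := T.l (x.1 0) with ha
  set b := T.l (x.1 1) with hb
  have eA : T.height (x.1 0) + T.height (T.pred^[a] T.base) =
      T.height T.base + T.height T.base := by
    rw [T.height_iterate_pred, T.height_base, LabelledTree.height, h0, ← ha]; push_cast; ring
  let A : DL T 3 := (id T 3).replace₂ (i := 0) (j := 2) (by decide) _ _ eA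
  have A0 : A.1 0 = x.1 0 := replace₂_apply_left _ _ _ _ _
  have A1 : A.1 1 = T.base := replace₂_apply_ne _ _ _ _ _ (by decide) (by decide)
  have A2 : A.1 2 = T.pred^[a] T.base := replace₂_apply_right _ _ _ _ _
  have eB : T.height (x.1 1) + T.height (T.pred^[b] (A.1 2)) =
      T.height (A.1 1) + T.height (A.1 2) := by
    rw [T.height_iterate_pred, A1, LabelledTree.height, h1, ← hb, T.height_base]; push_cast; ring
  let B : DL T 3 := A.replace₂ (i := 1) (j := 2) (by decide) _ _ eB
  have B0 : B.1 0 = x.1 0 :=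
    (replace₂_apply_ne _ _ _ _ _ (by decide) (by decide)).trans A0
  have B1 : B.1 1 = x.1 1 := replace₂_apply_left _ _ _ _ _
  have B2 : B.1 2 = T.pred^[b] (A.1 2) := replace₂_apply_right _ _ _ _ _
  have d1 : dist (id T 3) A ≤ a := dist_slide_le (i := 0) (j := 2) (by decide)
    (by rw [A0, p0]; rfl) A2
    fun k hk hk' => (replace₂_apply_ne _ _ _ _ _ hk hk').symm
  have d2 : dist A B ≤ b := dist_slide_le (i := 1) (j := 2) (by decide)
    (by rw [A1, B1, p1]; rfl) B2
    fun k hk hk' => (replace₂_apply_ne _ _ _ _ _ hk hk').symm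
  have d3 : dist B x ≤ _ := dist_le_of_forall_ne (i := 2) (j := 0) (by decide) fun k hk => by
    fin_cases k
    exacts [B0.symm, B1.symm, absurd rfl hk]
  rw [B2, A2, T.meetIndex_iterate_pred, T.meetIndex_iterate_pred, ← T.m_eq] at d3
  have := dist_triangle (id T 3) A B
  have := dist_triangle (id T 3) B x
  omega

/-- If `x` lay above the basepoint in tree `i`, a successor off the path to `x` would exist as `q ≥
2`. Starting there saves one descent in the third tree but wastes at least one step in tree `i`, so
it is no closer to `x` than `id`. -/
theorem l_eq_zero_of_dist_lt (hq : 2 ≤ q) {i : Fin 3} (hi : i ≠ 2) {x : DL T 3}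
    (h0 : T.m (x.1 0) = 0) (h1 : T.m (x.1 1) = 0)
    (h : ∀ a, dist x (succPoint T hi a) < dist x (id T 3)) : T.l (x.1 i) = 0 := by
  by_contra hl
  have hs : T.height (x.1 0) + T.height (x.1 1) + T.height (x.1 2) = 0 := by
    rw [← Fin.sum_univ_three fun k => T.height (x.1 k)]; exact x.2
  have hmi : T.m (x.1 i) = 0 := by
    fin_cases i
    exacts [h0, h1, absurd rfl hi]
  -- Makes `m` positive in the third tree, so that `m - 1` below is a true difference.
  have hli : T.l (x.1 i) ≤ T.m (x.1 2) := by
    simp only [LabelledTree.height, h0, h1] at hs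
    fin_cases i
    · change T.l (x.1 0) ≤ _; omega
    · change T.l (x.1 1) ≤ _; omega
    · exact absurd rfl hi
  obtain ⟨a, ha⟩ := T.exists_succ_ne hq T.base (T.pred^[T.l (x.1 i) - 1] (x.1 i))
  have e1 : (succPoint T hi a).1 i = T.succ T.base a := replace₂_apply_left _ _ _ _ _
  have e2 : (succPoint T hi a).1 2 = T.pred T.base := replace₂_apply_right _ _ _ _ _
  have h2 := meetIndex_add_le_dist hi (succPoint T hi a) x
  rw [e1, e2, T.meetIndex_pred, ← T.m_eq] at h2
  have h3 := T.height_sub_meetIndex (T.succ T.base a) (x.1 i)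
  have h4 := T.height_sub_meetIndex (T.pred T.base) (x.1 2)
  rw [T.height_succ, T.height_base, LabelledTree.height, hmi] at h3
  rw [T.height_pred, T.height_base, LabelledTree.height, T.meetIndex_pred, ← T.m_eq] at h4
  have h5 : T.meetIndex (T.succ T.base a) (x.1 i) ≠ 0 := fun h5 => by
    have := T.eq_of_meetIndex_eq_zero h5
    rw [show T.meetIndex (x.1 i) (T.succ T.base a) = T.l (x.1 i) - 1 by omega] at this
    exact ha this
  have h6 := dist_id_le h0 h1
  have h7 := h a
  rw [dist_comm x, dist_comm x] at h7
  omega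

theorem exists_mem_level_of_dist_lt (hq : 2 ≤ q) {w : V} (hw : T.pred w = T.pred T.base)
    {x : DL T 3}
    (h : ∀ i : Fin 3, i ≠ 2 → dist x (id T 3) < dist x (siblingPoint T i w hw))
    (h' : ∀ (i : Fin 3) (hi : i ≠ 2) (a), dist x (succPoint T hi a) < dist x (id T 3)) :
    ∃ n, x ∈ level T n := by
  have m0 := m_eq_zero_of_dist_lt hw (h 0 (by decide))
  have m1 := m_eq_zero_of_dist_lt hw (h 1 (by decide))
  have l0 := l_eq_zero_of_dist_lt hq (i := 0) (by decide) m0 m1 (h' 0 (by decide))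
  have l1 := l_eq_zero_of_dist_lt hq (i := 1) (by decide) m0 m1 (h' 1 (by decide))
  have hs : T.height (x.1 0) + T.height (x.1 1) + T.height (x.1 2) = 0 := by
    rw [← Fin.sum_univ_three fun k => T.height (x.1 k)]; exact x.2
  simp only [LabelledTree.height, m0, m1, l0, l1] at hs
  exact ⟨_, T.eq_base_of_m_l m0 l0, T.eq_base_of_m_l m1 l1, by omega, rfl⟩

end DL

/-! ### Topology of the compactification -/

namespace DL

variable {q : ℕ} {V : Type*} {T : LabelledTree q V} {d : ℕ}

/-- On a discrete space the compact-open topology is that of pointwise convergence. -/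
theorem isInducing_eval :
    IsInducing fun (y : Compactification T d) (z : DL T d) => y.1.1 z :=
  ContinuousMap.homeoFnOfDiscrete.isInducing.comp
    (IsInducing.subtypeVal.comp IsInducing.subtypeVal)

theorem continuous_eval (z : DL T d) : Continuous fun y : Compactification T d => y.1.1 z :=
  (continuous_apply z).comp isInducing_eval.continuous

theorem toCompactification_apply (x z : DL T d) :
    (toCompactification x).1.1 z = (dist x z : ℝ) - dist x (id T d) := rfl

theorem denseRange_toCompactification :
    DenseRange (toCompactification : DL T d → Compactification T d) := by
  intro y
  rw [IsInducing.subtypeVal.closure_eq_preimage_closure_image, ← Set.range_comp]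
  exact y.2

/-- The point of the compactification with prescribed values, when these are pointwise limits. -/
theorem exists_compactification_apply_eq {x : ℕ → DL T d} {b : DL T d → ℝ}
    (h : ∀ z, Tendsto (fun n => (dist (x n) z : ℝ) - dist (x n) (id T d)) atTop (𝓝 (b z))) :
    ∃ β : Compactification T d, ∀ z, β.1.1 z = b z := by
  have hb : b (id T d) = 0 := tendsto_nhds_unique (h _) (by simp)
  let f : BasedFun T d := ⟨⟨b, continuous_of_discreteTopology⟩, hb⟩
  have ht : Tendsto (fun n => toBasedFun (x n)) atTop (𝓝 f) := by
    refine tendsto_subtype_rng.2 ?_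
    rw [ContinuousMap.homeoFnOfDiscrete.isInducing.tendsto_nhds_iff, tendsto_pi_nhds]
    exact h
  exact ⟨⟨f, mem_closure_of_tendsto ht (Eventually.of_forall fun n => ⟨_, rfl⟩)⟩, fun _ => rfl⟩

theorem ext_apply {y y' : Compactification T d} (h : ∀ z, y.1.1 z = y'.1.1 z) : y = y' :=
  Subtype.ext (Subtype.ext (ContinuousMap.ext h))

/-- A point of an open set that contains only finitely many vertices is one of these vertices. -/
theorem mem_of_isOpen_of_finite {U S : Set (Compactification T d)} (hU : IsOpen U)
    (hS : S.Finite) (h : ∀ x, toCompactification x ∈ U → toCompactification x ∈ S)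
    {y : Compactification T d} (hy : y ∈ U) : y ∈ S := by
  rw [← hS.isClosed.closure_eq]
  refine closure_mono ?_ (denseRange_toCompactification.open_subset_closure_inter hU hy)
  rintro _ ⟨hx, x, rfl⟩
  exact h x hx

theorem dist_lt_iff {x z : DL T d} :
    (toCompactification x).1.1 z < 0 ↔ dist x z < dist x (id T d) := by
  rw [toCompactification_apply, sub_neg, Nat.cast_lt]

theorem lt_dist_iff {x z : DL T d} :
    0 < (toCompactification x).1.1 z ↔ dist x (id T d) < dist x z := by
  rw [toCompactification_apply, sub_pos, Nat.cast_lt]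

/-- If β were f_x, then x would lie in a level, so β(x) ≥ 0. But f_x(x) = -d(x,id), which forces
d(x,id) = 0 and hence f_x ≥ 0, contrary to a negative value of β. -/
theorem notMem_range {β : Compactification T 3}
    (hne : ∀ n, (level T n).Nonempty)
    (hlim : ∀ z, ∃ K, ∀ n, K ≤ n → ∀ x ∈ level T n, (toCompactification x).1.1 z = β.1.1 z)
    (hlevel : ∀ x, toCompactification x = β → ∃ n, x ∈ level T n)
    (hneg : ∃ z, β.1.1 z < 0) : β ∈ horoboundary T 3 := by
  rintro ⟨x, hx⟩
  obtain ⟨k, hk⟩ := hlevel x hx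
  obtain ⟨K, hK⟩ := hlim x
  obtain ⟨y, hy⟩ := hne (max K (k + 1))
  have h1 := hK _ (le_max_left _ _) y hy
  rw [← hx, toCompactification_apply, toCompactification_apply] at h1
  have h2 := two_mul_le_dist_of_mem_level hy hk (lt_of_lt_of_le (Nat.lt_succ_self k)
    (le_max_right _ _))
  rw [← dist_id_of_mem_level hy] at h2
  have h3 : (dist y (id T 3) : ℝ) ≤ dist y x := by exact_mod_cast h2
  have h4 : dist x x = 0 := SimpleGraph.dist_self
  have h5 : (0 : ℝ) ≤ dist x (id T 3) := Nat.cast_nonneg _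
  have h6 : (dist x (id T 3) : ℝ) = 0 := by
    rw [h4, Nat.cast_zero] at h1
    linarith
  obtain ⟨z, hz⟩ := hneg
  rw [← hx, toCompactification_apply, h6, sub_zero] at hz
  exact hz.not_ge (Nat.cast_nonneg _)

theorem basicNhd_mem_nhds {β : Compactification T 3}
    (hlim : ∀ z, ∃ K, ∀ n, K ≤ n → ∀ x ∈ level T n, (toCompactification x).1.1 z = β.1.1 z)
    (hβ : β ∈ horoboundary T 3) {W : Set (Compactification T 3)} (hW : IsOpen W) (hβW : β ∈ W)
    (hlevel : ∀ x, toCompactification x ∈ W → ∃ n, x ∈ level T n) (k : ℕ) :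
    basicNhd β k ∈ 𝓝 β := by
  have hfin : ∀ K : ℕ, (toCompactification '' ⋃ n ∈ Set.Iio K, level T n).Finite := fun K =>
    ((Set.finite_Iio K).biUnion fun n _ => level_finite n).image _
  have hmem : (toCompactification '' ⋃ n ∈ Set.Iio k, level T n)ᶜ ∈ 𝓝 β :=
    (hfin k).isClosed.isOpen_compl.mem_nhds fun ⟨x, _, hx⟩ => hβ ⟨x, hx⟩
  filter_upwards [hW.mem_nhds hβW, hmem] with y hy hy'
  rw [mem_basicNhd]
  by_cases hyβ : y = β
  · exact Or.inr hyβ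
  obtain ⟨z, hz⟩ : ∃ z, y.1.1 z ≠ β.1.1 z := by
    by_contra! h
    exact hyβ (ext_apply h)
  obtain ⟨K, hK⟩ := hlim z
  -- A vertex of `W` that differs from β at `z` lies in a level below `K`.
  obtain ⟨x, hx, rfl⟩ := mem_of_isOpen_of_finite
    (hW.inter (isOpen_ne.preimage (continuous_eval z))) (hfin K)
    (fun x hx => by
      obtain ⟨n, hn⟩ := hlevel x hx.1
      have : n < K := not_le.1 fun h => hx.2 (hK n h x hn)
      exact ⟨x, Set.mem_biUnion this hn, rfl⟩) ⟨hy, hz⟩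
  obtain ⟨n, -, hn⟩ := Set.mem_iUnion₂.1 hx
  exact Or.inl ⟨n, not_lt.1 fun h => hy' ⟨x, Set.mem_biUnion h hn, rfl⟩, x, hn, rfl⟩

theorem exists_basicNhd_subset {β : Compactification T 3}
    (hlim : ∀ z, ∃ K, ∀ n, K ≤ n → ∀ x ∈ level T n, (toCompactification x).1.1 z = β.1.1 z)
    {U : Set (Compactification T 3)} (hU : U ∈ 𝓝 β) : ∃ k, basicNhd β k ⊆ U := by
  rw [isInducing_eval.nhds_eq_comap, mem_comap] at hU
  obtain ⟨t, ht, htU⟩ := hU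
  rw [nhds_pi, Filter.mem_pi] at ht
  obtain ⟨I, hI, s, hs, hst⟩ := ht
  choose K hK using hlim
  refine ⟨hI.toFinset.sup K, fun y hy => htU (hst fun z hz => ?_)⟩
  suffices y.1.1 z = β.1.1 z by
    simp only [this]
    exact mem_of_mem_nhds (hs z)
  obtain ⟨n, hn, x, hx, rfl⟩ | rfl := mem_basicNhd.1 hy
  · exact hK z n ((Finset.le_sup (hI.mem_toFinset.2 hz)).trans hn) x hx
  · rfl

end DL

theorem mainTheorem7 {q : ℕ} (hq : 2 ≤ q) {V : Type*} (T : LabelledTree q V)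
    (hT : ∀ n : ℕ, T.succ (T.pred^[n + 1] T.base) ⟨1, hq⟩ ≠ T.pred^[n] T.base) :
    ∃ β : DL.Compactification T 3, β ∈ DL.horoboundary T 3 ∧
      (∀ z : DL T 3, Tendsto
        (fun n : ℕ => (DL.dist (DL.betaSeq T ⟨1, hq⟩ n) z : ℝ) -
          (DL.dist (DL.betaSeq T ⟨1, hq⟩ n) (DL.id T 3) : ℝ))
        atTop (𝓝 (β.1.1 z))) ∧
      (𝓝 β).HasBasis (fun _ : ℕ => True) (fun k : ℕ => DL.basicNhd β k) := by
  have hB := DL.betaSeq_mem_level hT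
  have hne : ∀ n, (DL.level T n).Nonempty := fun n => ⟨_, hB n⟩
  choose b K hK using DL.exists_limit hne
  have hlim : ∀ z, Tendsto (fun n : ℕ => (DL.dist (DL.betaSeq T ⟨1, hq⟩ n) z : ℝ) -
      (DL.dist (DL.betaSeq T ⟨1, hq⟩ n) (DL.id T 3) : ℝ)) atTop (𝓝 (b z : ℝ)) := fun z => by
    refine tendsto_const_nhds.congr' ?_
    filter_upwards [eventually_ge_atTop (K z)] with n hn
    rw [← hK z n hn _ (hB n)]
    push_cast
    rfl
  obtain ⟨β, hβ⟩ := DL.exists_compactification_apply_eq hlim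
  have hK' : ∀ z, ∃ K, ∀ n, K ≤ n → ∀ x ∈ DL.level T n,
      (DL.toCompactification x).1.1 z = β.1.1 z := fun z => ⟨K z, fun n hn x hx => by
    rw [hβ, DL.toCompactification_apply, ← hK z n hn x hx]
    push_cast
    rfl⟩
  -- The sibling of the basepoint with label 1; it is not the basepoint itself by `hT 0`.
  have hw : T.pred (T.succ (T.pred T.base) ⟨1, hq⟩) = T.pred T.base := T.pred_succ _ _
  have hpos : ∀ i : Fin 3, i ≠ 2 → 0 < β.1.1 (DL.siblingPoint T i _ hw) := fun i hi => by
    obtain ⟨K, hK⟩ := hK' (DL.siblingPoint T i _ hw)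
    rw [← hK K le_rfl _ (hB K), DL.lt_dist_iff]
    exact DL.dist_id_lt_dist_siblingPoint hi hw (hT 0) (hB K)
  have hneg : ∀ (i : Fin 3) (hi : i ≠ 2) (a : Fin q), β.1.1 (DL.succPoint T hi a) < 0 :=
    fun i hi a => by
      obtain ⟨K, hK⟩ := hK' (DL.succPoint T hi a)
      -- `K + 1` because the inequality fails at level 0, which is `id` itself.
      rw [← hK (K + 1) (Nat.le_succ K) _ (hB _), DL.dist_lt_iff]
      exact DL.dist_succPoint_lt_dist_id hi a K.succ_pos (hB _)
  let W : Set (DL.Compactification T 3) :=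
    {y | ∀ i : Fin 3, i ≠ 2 → 0 < y.1.1 (DL.siblingPoint T i _ hw)} ∩
      {y | ∀ (i : Fin 3) (hi : i ≠ 2) (a : Fin q), y.1.1 (DL.succPoint T hi a) < 0}
  have hW : IsOpen W := by
    simp only [W, Set.ofPred_forall]
    exact (isOpen_iInter_of_finite fun i => isOpen_iInter_of_finite fun hi =>
      isOpen_lt continuous_const (DL.continuous_eval _)).inter
      (isOpen_iInter_of_finite fun i => isOpen_iInter_of_finite fun hi =>
      isOpen_iInter_of_finite fun a => isOpen_lt (DL.continuous_eval _) continuous_const)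
  have hlevel : ∀ x, DL.toCompactification x ∈ W → ∃ n, x ∈ DL.level T n := fun x hx =>
    DL.exists_mem_level_of_dist_lt hq hw (fun i hi => DL.lt_dist_iff.1 (hx.1 i hi))
      fun i hi a => DL.dist_lt_iff.1 (hx.2 i hi a)
  have hβW : β ∈ W := ⟨hpos, hneg⟩
  have hβ' : β ∈ DL.horoboundary T 3 := DL.notMem_range hne hK'
    (fun x hx => hlevel x (hx ▸ hβW)) ⟨_, hneg 0 (by decide) ⟨1, hq⟩⟩
  refine ⟨β, hβ', fun z => hβ z ▸ hlim z, ⟨fun U => ⟨fun hU => ?_, ?_⟩⟩⟩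
  · obtain ⟨k, hk⟩ := DL.exists_basicNhd_subset hK' hU
    exact ⟨k, trivial, hk⟩
  · rintro ⟨k, -, hk⟩
    exact mem_of_superset (DL.basicNhd_mem_nhds hK' hβ' hW hβW hlevel k) hk
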